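/- All maps below are linear over $\mathbb{C}$, and positivity and norms of matrices refer to the $C^*$-algebras $M_r(\cdot)$. A linear map $\theta\colon A\to B$ between $C^*$-algebras is completely positive (c.p.) if $\theta^{(r)}\colon M_r(A)\to M_r(B)$ maps positive matrices to positive matrices for every $r\ge 1$; it is c.p.c. if moreover $\|\theta^{(r)}\|\le 1$ for every $r$. Let $(F_n)_{n\ge 0}$ be finite-dimensional $C^*$-algebras and $\rho_{n+1,n}\colon F_n\to F_{n+1}$ c.p.c. maps. Put $\rho_{m,n}=\rho_{m,m-1}\circ\cdots\circ\rho_{n+1,n}$ for $m>n$, $\rho_{n,n}=\mathrm{id}_{F_n}$, let $F_\infty=\prod_n F_n/\bigoplus_n F_n$ be the $C^*$-algebra of bounded sequences modulo null sequences, and $\rho_n\colon F_n\to F_\infty$, $\rho_n(x)=[(\rho_{m,n}(x))_{m>n}]$. Assume that $(F_n,\rho_{n+1,n})_n$ is a $\mathrm{CPC}^*$-system: for all $k\ge 0$, $x,y\in F_k$ and $\varepsilon>0$ there is $M>k$ such that for all $m,n,l$ with $m>n>M$ and $m>l>M$, $$\big\|\rho_{m,l}(1_{F_l})\,\rho_{m,n}\big(\rho_{n,k}(x)\rho_{n,k}(y)\big)-\rho_{m,k}(x)\rho_{m,k}(y)\big\|<\varepsilon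 .$$ Let $X=\overline{\bigcup_n\rho_n(F_n)}\subset F_\infty$ and $e=[(\rho_{n+1,n}(1_{F_n}))_n]\in F_\infty$. For $a,b\in X$ let $a\bullet b$ be the unique element of $X$ with $e(a\bullet b)=ab$ in $F_\infty$; it satisfies $\rho_k(x)\bullet\rho_k(y)=\lim_n\rho_n(\rho_{n,k}(x)\rho_{n,k}(y))$ for all $k$ and $x,y\in F_k$. With the product $\bullet$ and the linear structure, involution and norm of $F_\infty$, $X$ is a $C^*$-algebra, denoted $C^*_\bullet(X)$. Then the identity map $\Theta=\mathrm{id}_X\colon C^*_\bullet(X)\to F_\infty$ is an order zero complete order embedding. That is: 1. $\Theta$ is completely positive, and $\Theta(a)\Theta(b)=0$ in $F_\infty$ whenever $a,b\in C^*_\bullet(X)$ are positive with $a\bullet b=0$; 2. $\Theta$ is completely isometric, i.e. $\|\Theta^{(r)}(x)\|=\|x\|$ for all $r\ge1$ and $x\in M_r(C^*_\bullet(X))$; 3. the inverse $\Theta^{-1}\colon\Theta(X)\to C^*_\bullet(X)$ is completely positive, i.e. for all $r\ge 1$, every matrix in $M_r(\Theta(X))$ that is positive in $M_r(F_\infty)$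 is mapped by $(\Theta^{-1})^{(r)}$ to a positive element of $M_r(C^*_\bullet(X))$. -/

import Mathlib

open Filter Topology
open scoped ENNReal

noncomputable section

namespace CPCStar

/-! ### The sequence algebra `∏ F n / ⨁ F n` -/

section SeqAlg

variable (F : ℕ → Type*) [∀ n, NonUnitalCStarAlgebra (F n)]

/-- The null sequences, as a subspace of the bounded sequences `∏ F n = lp F ∞`. -/
def nullSeq : Submodule ℂ (lp F ∞) where
  carrier := {x | Tendsto (fun n => ‖x n‖) atTop (𝓝 0)}
  zero_mem' := by simp
  add_mem' := by
    intro a b ha hb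
    refine squeeze_zero (fun n => norm_nonneg _) (fun n => norm_add_le (a n) (b n)) ?_
    simpa using Tendsto.add ha hb
  smul_mem' := by
    intro c x hx
    have h : ∀ n, ‖(c • x) n‖ = ‖c‖ * ‖x n‖ := fun n => norm_smul c (x n)
    simp only [Set.mem_ofPred_eq, h]
    simpa using Tendsto.const_mul ‖c‖ hx

variable {F}

theorem mem_nullSeq {x : lp F ∞} :
    x ∈ nullSeq F ↔ Tendsto (fun n => ‖x n‖) atTop (𝓝 0) := Iff.rfl

theorem norm_apply_le (x : lp F ∞) (n : ℕ) : ‖x n‖ ≤ ‖x‖ :=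
  lp.norm_apply_le_norm ENNReal.top_ne_zero x n

instance isClosed_nullSeq : IsClosed (nullSeq F : Set (lp F ∞)) := by
  rw [← isSeqClosed_iff_isClosed]
  intro x a hx ha
  rw [SetLike.mem_coe, mem_nullSeq, Metric.tendsto_atTop]
  intro ε hε
  obtain ⟨N, hN⟩ := (Metric.tendsto_atTop.1 ha) (ε / 2) (half_pos hε)
  obtain ⟨M, hM⟩ := (Metric.tendsto_atTop.1 (mem_nullSeq.1 (hx N))) (ε / 2) (half_pos hε)
  refine ⟨M, fun n hn => ?_⟩
  have h1 := hM n hn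
  have h2 := hN N le_rfl
  rw [dist_eq_norm] at h2
  simp only [dist_zero_right, norm_norm] at h1 ⊢
  have h3 : ‖(x N - a) n‖ ≤ ‖x N - a‖ := norm_apply_le _ n
  have h4 : ‖a n‖ ≤ ‖x N n‖ + ‖(x N - a) n‖ := by
    have : a n = x N n - (x N - a) n := by
      change a n = x N n - (x N n - a n)
      abel
    rw [this]
    exact norm_sub_le _ _
  linarith

theorem mul_mem_nullSeq_left (x : lp F ∞) {y : lp F ∞} (hy : y ∈ nullSeq F) :
    x * y ∈ nullSeq F := by
  rw [mem_nullSeq] at hy ⊢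
  refine squeeze_zero (fun n => norm_nonneg _) (fun n => ?_)
    (by simpa using hy.const_mul ‖x‖)
  exact (norm_mul_le (x n) (y n)).trans (by gcongr; exact norm_apply_le x n)

theorem mul_mem_nullSeq_right {x : lp F ∞} (hx : x ∈ nullSeq F) (y : lp F ∞) :
    x * y ∈ nullSeq F := by
  rw [mem_nullSeq] at hx ⊢
  refine squeeze_zero (fun n => norm_nonneg _) (fun n => ?_)
    (by simpa using hx.mul_const ‖y‖)
  exact (norm_mul_le (x n) (y n)).trans (by gcongr; exact norm_apply_le y n)

theorem star_mem_nullSeq {x : lp F ∞} (hx : x ∈ nullSeq F) : star x ∈ nullSeq F := by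
  rw [mem_nullSeq] at hx ⊢
  simpa using hx

variable (F) in
/-- `F_∞ = ∏ F n / ⨁ F n`: bounded sequences modulo null sequences, with the quotient norm. -/
def SeqAlg := lp F ∞ ⧸ nullSeq F

namespace SeqAlg

instance : NormedAddCommGroup (SeqAlg F) := inferInstanceAs (NormedAddCommGroup (lp F ∞ ⧸ nullSeq F))

instance : NormedSpace ℂ (SeqAlg F) := inferInstanceAs (NormedSpace ℂ (lp F ∞ ⧸ nullSeq F))

instance : CompleteSpace (SeqAlg F) := inferInstanceAs (CompleteSpace (lp F ∞ ⧸ nullSeq F))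

variable (F) in
/-- The class `[(x_n)_n]` of a bounded sequence. -/
def mk : lp F ∞ →ₗ[ℂ] SeqAlg F := (nullSeq F).mkQ

theorem mk_surjective : Function.Surjective (mk F) := (nullSeq F).mkQ_surjective

theorem mk_eq_mk {x y : lp F ∞} : mk F x = mk F y ↔ x - y ∈ nullSeq F :=
  Submodule.Quotient.eq (nullSeq F)

instance : Mul (SeqAlg F) where
  mul := Quotient.map₂ (· * ·) (by
    intro a b hab c d hcd
    have hab' : a - b ∈ nullSeq F := (Submodule.quotientRel_def _).1 hab
    have hcd' : c - d ∈ nullSeq F := (Submodule.quotientRel_def _).1 hcd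
    refine (Submodule.quotientRel_def _).2 ?_
    have h : a * c - b * d = (a - b) * c + b * (c - d) := by noncomm_ring
    rw [h]
    exact add_mem (mul_mem_nullSeq_right hab' c) (mul_mem_nullSeq_left b hcd'))

instance : Star (SeqAlg F) where
  star := Quotient.map star (by
    intro a b hab
    have hab' : a - b ∈ nullSeq F := (Submodule.quotientRel_def _).1 hab
    refine (Submodule.quotientRel_def _).2 ?_
    rw [← star_sub]
    exact star_mem_nullSeq hab')

theorem mk_mul (x y : lp F ∞) : mk F (x * y) = mk F x * mk F y := rfl

theorem mk_star (x : lp F ∞) : mk F (star x) = star (mk F x) := rfl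

theorem norm_mk_le (x : lp F ∞) : ‖mk F x‖ ≤ ‖x‖ := Submodule.Quotient.norm_mk_le _ x

theorem exists_lift (a : SeqAlg F) {C : ℝ} (h : ‖a‖ < C) : ∃ x, mk F x = a ∧ ‖x‖ < C := by
  obtain ⟨x, hx, hx'⟩ := Submodule.Quotient.norm_mk_lt (S := nullSeq F) a (sub_pos.2 h)
  exact ⟨x, hx, hx'.trans_eq (by change ‖a‖ + (C - ‖a‖) = C; ring)⟩

instance : NonUnitalRing (SeqAlg F) where
  left_distrib a b c := by
    obtain ⟨a, rfl⟩ := mk_surjective a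
    obtain ⟨b, rfl⟩ := mk_surjective b
    obtain ⟨c, rfl⟩ := mk_surjective c
    simp only [← map_add, ← mk_mul, mul_add]
  right_distrib a b c := by
    obtain ⟨a, rfl⟩ := mk_surjective a
    obtain ⟨b, rfl⟩ := mk_surjective b
    obtain ⟨c, rfl⟩ := mk_surjective c
    simp only [← map_add, ← mk_mul, add_mul]
  zero_mul a := by
    obtain ⟨a, rfl⟩ := mk_surjective a
    rw [← map_zero (mk F), ← mk_mul, zero_mul]
  mul_zero a := by
    obtain ⟨a, rfl⟩ := mk_surjective a
    rw [← map_zero (mk F), ← mk_mul, mul_zero]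
  mul_assoc a b c := by
    obtain ⟨a, rfl⟩ := mk_surjective a
    obtain ⟨b, rfl⟩ := mk_surjective b
    obtain ⟨c, rfl⟩ := mk_surjective c
    simp only [← mk_mul, mul_assoc]

instance : NonUnitalNormedRing (SeqAlg F) where
  dist_eq := NormedAddGroup.dist_eq
  norm_mul_le a b := by
    refine le_of_forall_pos_le_add fun ε hε => ?_
    have hc : Tendsto (fun t : ℝ => (‖a‖ + t) * (‖b‖ + t)) (𝓝[>] 0) (𝓝 (‖a‖ * ‖b‖)) := by
      have : Continuous fun t : ℝ => (‖a‖ + t) * (‖b‖ + t) := by fun_prop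
      simpa using (this.tendsto 0).mono_left nhdsWithin_le_nhds
    obtain ⟨t, ht, ht0⟩ := ((hc.eventually (gt_mem_nhds (lt_add_of_pos_right _ hε))).and
      self_mem_nhdsWithin).exists
    have ht0 : (0 : ℝ) < t := ht0
    obtain ⟨x, rfl, hx⟩ := exists_lift a (lt_add_of_pos_right ‖a‖ ht0)
    obtain ⟨y, rfl, hy⟩ := exists_lift b (lt_add_of_pos_right ‖b‖ ht0)
    rw [← mk_mul]
    refine ((norm_mk_le _).trans (norm_mul_le x y)).trans (le_trans ?_ ht.le)
    gcongr

instance : StarRing (SeqAlg F) where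
  star_involutive a := by
    obtain ⟨a, rfl⟩ := mk_surjective a
    simp only [← mk_star, star_star]
  star_mul a b := by
    obtain ⟨a, rfl⟩ := mk_surjective a
    obtain ⟨b, rfl⟩ := mk_surjective b
    simp only [← mk_star, ← mk_mul, star_mul]
  star_add a b := by
    obtain ⟨a, rfl⟩ := mk_surjective a
    obtain ⟨b, rfl⟩ := mk_surjective b
    simp only [← mk_star, ← map_add, star_add]

/-- An element of `∏ F n` that is eventually bounded by `C` has a class of norm at most `C`. -/
theorem norm_mk_le_of_eventually {x : lp F ∞} {C : ℝ} (hC : 0 ≤ C)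
    (h : ∀ᶠ n in atTop, ‖x n‖ ≤ C) : ‖mk F x‖ ≤ C := by
  classical
  obtain ⟨N, hN⟩ := eventually_atTop.1 h
  have hb : ∀ n, ‖(if N ≤ n then x n else 0 : F n)‖ ≤ C := by
    intro n
    split_ifs with hn
    · exact hN n hn
    · simpa using hC
  let y : lp F ∞ := ⟨fun n => if N ≤ n then x n else 0,
    memℓp_infty ⟨C, by rintro _ ⟨n, rfl⟩; exact hb n⟩⟩
  have hxy : mk F x = mk F y := by
    rw [mk_eq_mk, mem_nullSeq]
    refine tendsto_const_nhds.congr' ?_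
    filter_upwards [eventually_ge_atTop N] with n hn
    have : (x - y) n = x n - (if N ≤ n then x n else 0) := rfl
    rw [this, if_pos hn, sub_self, norm_zero]
  rw [hxy]
  exact (norm_mk_le y).trans (lp.norm_le_of_forall_le hC hb)

theorem eventually_norm_lt {x : lp F ∞} {C : ℝ} (h : ‖mk F x‖ < C) :
    ∀ᶠ n in atTop, ‖x n‖ < C := by
  obtain ⟨y, hy, hyC⟩ := exists_lift _ h
  have h0 : Tendsto (fun n => ‖(x - y) n‖) atTop (𝓝 0) := mem_nullSeq.1 (mk_eq_mk.1 hy.symm)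
  filter_upwards [h0.eventually (gt_mem_nhds (sub_pos.2 hyC))] with n hn
  have h1 : x n = y n + (x - y) n := by
    change x n = y n + (x n - y n)
    abel
  rw [h1]
  have := norm_add_le (y n) ((x - y) n)
  have := norm_apply_le y n
  linarith

instance : CStarRing (SeqAlg F) where
  norm_mul_self_le a := by
    obtain ⟨x, rfl⟩ := mk_surjective a
    refine le_of_forall_gt_imp_ge_of_dense fun C hC => ?_
    rw [← mk_star, ← mk_mul] at hC
    have hC0 : 0 ≤ C := (norm_nonneg _).trans hC.le
    have h : ‖mk F x‖ ≤ √C := by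
      refine norm_mk_le_of_eventually (Real.sqrt_nonneg _) ?_
      filter_upwards [eventually_norm_lt hC] with n hn
      refine Real.le_sqrt_of_sq_le ?_
      rw [sq, ← CStarRing.norm_star_mul_self]
      exact hn.le
    calc ‖mk F x‖ * ‖mk F x‖ ≤ √C * √C := by gcongr
      _ = C := Real.mul_self_sqrt hC0

instance : NonUnitalCStarAlgebra (SeqAlg F) where
  smul_assoc c a b := by
    obtain ⟨a, rfl⟩ := mk_surjective a
    obtain ⟨b, rfl⟩ := mk_surjective b
    simp only [smul_eq_mul, ← map_smul, ← mk_mul, smul_mul_assoc]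
  smul_comm c a b := by
    obtain ⟨a, rfl⟩ := mk_surjective a
    obtain ⟨b, rfl⟩ := mk_surjective b
    simp only [smul_eq_mul, ← map_smul, ← mk_mul, mul_smul_comm]
  star_smul c a := by
    obtain ⟨a, rfl⟩ := mk_surjective a
    simp only [← map_smul, ← mk_star, star_smul]

instance : PartialOrder (SeqAlg F) := CStarAlgebra.spectralOrder _

instance : StarOrderedRing (SeqAlg F) := CStarAlgebra.spectralOrderedRing _

theorem mk_nonneg [∀ n, PartialOrder (F n)] [∀ n, StarOrderedRing (F n)] {x : lp F ∞}
    (h : ∀ᶠ n in atTop, 0 ≤ x n) : 0 ≤ mk F x := by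
  classical
  have h1 : ∀ n, ∃ s : F n, ‖s‖ ^ 2 ≤ ‖x‖ ∧ (0 ≤ x n → x n = star s * s) := by
    intro n
    by_cases hn : 0 ≤ x n
    · obtain ⟨s, hs⟩ := CStarAlgebra.nonneg_iff_eq_star_mul_self.1 hn
      refine ⟨s, ?_, fun _ => hs⟩
      rw [sq, ← CStarRing.norm_star_mul_self, ← hs]
      exact norm_apply_le x n
    · exact ⟨0, by simp, fun h => absurd h hn⟩
  choose s hs hs' using h1
  let y : lp F ∞ := ⟨s, memℓp_infty ⟨√‖x‖, by
    rintro _ ⟨n, rfl⟩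
    exact Real.le_sqrt_of_sq_le (hs n)⟩⟩
  have hxy : mk F x = star (mk F y) * mk F y := by
    rw [← mk_star, ← mk_mul, mk_eq_mk, mem_nullSeq]
    refine tendsto_const_nhds.congr' ?_
    filter_upwards [h] with n hn
    have : (x - star y * y) n = x n - star (s n) * s n := rfl
    rw [this, ← hs' n hn, sub_self, norm_zero]
  rw [hxy]
  exact star_mul_self_nonneg _

end SeqAlg

end SeqAlg

/-! ### Systems of completely positive contractive maps -/

/-- The composition `f (m-1) ∘ ⋯ ∘ f n : F n → F m` for `n ≤ m` (the identity for `n = m`);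
for `m < n` it is the zero map, which never matters. -/
def conn {F : ℕ → Type*} [∀ n, AddCommGroup (F n)] [∀ n, Module ℂ (F n)]
    (f : ∀ n, F n →ₗ[ℂ] F (n + 1)) (m n : ℕ) : F n →ₗ[ℂ] F m :=
  if h : n ≤ m then
    Nat.leRec (motive := fun m _ => F n →ₗ[ℂ] F m) LinearMap.id (fun k _ g => (f k).comp g) h
  else 0

/-- A sequence of C⋆-algebras with completely positive, completely contractive connecting maps
`F n → F (n + 1)`. -/
structure CPCSystem (F : ℕ → Type*) [∀ n, CStarAlgebra (F n)] [∀ n, PartialOrder (F n)]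
    [∀ n, StarOrderedRing (F n)] where
  map : ∀ n, CompletelyPositiveMap (F n) (F (n + 1))
  completelyContractive : ∀ (n r : ℕ) (M : CStarMatrix (Fin r) (Fin r) (F n)),
    ‖M.map (map n)‖ ≤ ‖M‖

namespace CPCSystem

variable {F : ℕ → Type*} [∀ n, CStarAlgebra (F n)] [∀ n, PartialOrder (F n)]
  [∀ n, StarOrderedRing (F n)] (S : CPCSystem F)

/-- The connecting map `ρ_{m,n} : F n → F m`, for `n ≤ m`. -/
def trans (m n : ℕ) : F n →ₗ[ℂ] F m := conn (fun k => (S.map k).toLinearMap) m n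

theorem trans_self (n : ℕ) (x : F n) : S.trans n n x = x := by
  simp [trans, conn]

theorem trans_succ {m n : ℕ} (h : n ≤ m) (x : F n) :
    S.trans (m + 1) n x = S.map m (S.trans m n x) := by
  simp only [trans, conn, dif_pos h, dif_pos (Nat.le_succ_of_le h)]
  rw [Nat.leRec_succ _ _ h]
  rfl

theorem trans_of_lt {m n : ℕ} (h : m < n) (x : F n) : S.trans m n x = 0 := by
  simp [trans, conn, Nat.not_le.2 h]

theorem trans_trans {k n m : ℕ} (h1 : k ≤ n) (h2 : n ≤ m) (x : F k) :
    S.trans m n (S.trans n k x) = S.trans m k x := by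
  induction m, h2 using Nat.le_induction with
  | base => exact S.trans_self n _
  | succ m h2 ih => rw [S.trans_succ h2, ih, S.trans_succ (h1.trans h2)]

theorem norm_map_le (n : ℕ) (x : F n) : ‖S.map n x‖ ≤ ‖x‖ := by
  let φ : F n →⋆ₙₐ[ℂ] CStarMatrix (Fin 1) (Fin 1) (F n) :=
    { toFun := fun a => CStarMatrix.ofMatrix fun _ _ => a
      map_smul' := fun _ _ => rfl
      map_zero' := rfl
      map_add' := fun _ _ => rfl
      map_mul' := fun a b => by
        ext i j
        simp only [CStarMatrix.mul_apply, Fin.sum_univ_one]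
        rfl
      map_star' := fun _ => rfl }
  let M : CStarMatrix (Fin 1) (Fin 1) (F n) := φ x
  have hM : ‖M‖ ≤ ‖x‖ := NonUnitalStarAlgHom.norm_apply_le φ x
  have h1 : ‖(M.map (S.map n)) 0 0‖ ≤ ‖M.map (S.map n)‖ := CStarMatrix.norm_entry_le_norm
  exact (h1.trans (S.completelyContractive n 1 M)).trans hM

theorem map_nonneg' (n : ℕ) {x : F n} (hx : 0 ≤ x) : 0 ≤ S.map n x := map_nonneg (S.map n) hx

theorem norm_trans_le (m n : ℕ) (x : F n) : ‖S.trans m n x‖ ≤ ‖x‖ := by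
  rcases lt_or_ge m n with h | h
  · rw [S.trans_of_lt h]; simp
  · induction m, h using Nat.le_induction with
    | base => rw [S.trans_self]
    | succ m h ih => rw [S.trans_succ h]; exact (S.norm_map_le m _).trans ih

theorem trans_nonneg (m n : ℕ) {x : F n} (hx : 0 ≤ x) : 0 ≤ S.trans m n x := by
  rcases lt_or_ge m n with h | h
  · rw [S.trans_of_lt h]
  · induction m, h using Nat.le_induction with
    | base => rwa [S.trans_self]
    | succ m h ih => rw [S.trans_succ h]; exact S.map_nonneg' m ih

theorem trans_star (m n : ℕ) (x : F n) : S.trans m n (star x) = star (S.trans m n x) := by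
  rcases lt_or_ge m n with h | h
  · simp [S.trans_of_lt h]
  · induction m, h using Nat.le_induction with
    | base => simp [S.trans_self]
    | succ m h ih => rw [S.trans_succ h, ih, S.trans_succ h]; exact map_star (S.map m) _

/-- The bounded sequence `(ρ_{m,n}(x))_m`; its entries for `m < n` are zero. -/
def transSeq (n : ℕ) : F n →ₗ[ℂ] lp F ∞ where
  toFun x := ⟨fun m => S.trans m n x, memℓp_infty ⟨‖x‖, by
    rintro _ ⟨m, rfl⟩
    exact S.norm_trans_le m n x⟩⟩
  map_add' x y := by
    ext m
    exact map_add (S.trans m n) x y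
  map_smul' c x := by
    ext m
    exact map_smul (S.trans m n) c x

theorem transSeq_apply (n m : ℕ) (x : F n) : S.transSeq n x m = S.trans m n x := rfl

/-- The induced map `ρ_n : F n → F_∞`, `ρ_n(x) = [(ρ_{m,n}(x))_m]`. -/
def rho (n : ℕ) : F n →ₗ[ℂ] SeqAlg F := (SeqAlg.mk F).comp (S.transSeq n)

theorem rho_apply (n : ℕ) (x : F n) : S.rho n x = SeqAlg.mk F (S.transSeq n x) := rfl

theorem rho_trans {k n : ℕ} (h : k ≤ n) (x : F k) : S.rho n (S.trans n k x) = S.rho k x := by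
  rw [rho_apply, rho_apply, SeqAlg.mk_eq_mk, mem_nullSeq]
  refine tendsto_const_nhds.congr' ?_
  filter_upwards [eventually_ge_atTop n] with m hm
  have : (S.transSeq n (S.trans n k x) - S.transSeq k x) m
      = S.trans m n (S.trans n k x) - S.trans m k x := rfl
  rw [this, S.trans_trans h hm, sub_self, norm_zero]

theorem norm_rho_le (n : ℕ) (x : F n) : ‖S.rho n x‖ ≤ ‖x‖ :=
  SeqAlg.norm_mk_le_of_eventually (norm_nonneg x)
    (Eventually.of_forall fun m => S.norm_trans_le m n x)

theorem rho_nonneg (n : ℕ) {x : F n} (hx : 0 ≤ x) : 0 ≤ S.rho n x :=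
  SeqAlg.mk_nonneg (Eventually.of_forall fun m => S.trans_nonneg m n hx)

theorem rho_star (n : ℕ) (x : F n) : S.rho n (star x) = star (S.rho n x) := by
  rw [rho_apply, rho_apply, ← SeqAlg.mk_star]
  congr 1
  ext m
  exact S.trans_star m n x

theorem range_rho_mono : Monotone fun n => LinearMap.range (S.rho n) := by
  rintro k n h _ ⟨x, rfl⟩
  exact ⟨S.trans n k x, S.rho_trans h x⟩

/-- The inductive limit of the system: the closure of `⋃ n, ρ_n (F n)` in `F_∞`. -/
def limit : Submodule ℂ (SeqAlg F) := (⨆ n, LinearMap.range (S.rho n)).topologicalClosure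

theorem coe_limit : (S.limit : Set (SeqAlg F)) = closure (⋃ n, Set.range (S.rho n)) := by
  rw [limit, Submodule.topologicalClosure_coe,
    Submodule.coe_iSup_of_directed _ S.range_rho_mono.directed_le]
  rfl

theorem rho_mem (n : ℕ) (x : F n) : S.rho n x ∈ S.limit := by
  rw [← SetLike.mem_coe, coe_limit]
  exact subset_closure (Set.mem_iUnion.2 ⟨n, x, rfl⟩)

theorem limit_subset {s : Set (SeqAlg F)} (hs : IsClosed s) (h : ∀ n x, S.rho n x ∈ s)
    {a : SeqAlg F} (ha : a ∈ S.limit) : a ∈ s := by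
  rw [← SetLike.mem_coe, coe_limit] at ha
  refine closure_minimal ?_ hs ha
  rintro _ ⟨_, ⟨n, rfl⟩, x, rfl⟩
  exact h n x

theorem isClosed_limit : IsClosed (S.limit : Set (SeqAlg F)) :=
  Submodule.isClosed_topologicalClosure _

theorem star_mem_limit {a : SeqAlg F} (ha : a ∈ S.limit) : star a ∈ S.limit := by
  refine S.limit_subset (s := {a | star a ∈ S.limit})
    (S.isClosed_limit.preimage continuous_star) (fun n x => ?_) ha
  rw [Set.mem_ofPred_eq, ← rho_star]
  exact S.rho_mem n _

theorem norm_one_le' (n : ℕ) : ‖(1 : F n)‖ ≤ 1 :=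
  (CStarAlgebra.norm_le_one_iff_of_nonneg (1 : F n) zero_le_one).2 le_rfl

/-- The sequence `(ρ_{n+1,n}(1))_n`, placed in the coordinates `n + 1`. -/
def unitSeq : lp F ∞ :=
  ⟨fun m => match m with
    | 0 => 0
    | n + 1 => S.map n 1, memℓp_infty ⟨1, by
      rintro _ ⟨m, rfl⟩
      cases m with
      | zero => simp
      | succ n => exact (S.norm_map_le n 1).trans (norm_one_le' n)⟩⟩

theorem unitSeq_succ (n : ℕ) : S.unitSeq (n + 1) = S.map n 1 := rfl

/-- The distinguished order unit `e = [(ρ_{n+1,n}(1))_n]` of `F_∞`. -/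
def e : SeqAlg F := SeqAlg.mk F S.unitSeq

theorem e_nonneg : 0 ≤ S.e := by
  refine SeqAlg.mk_nonneg ?_
  filter_upwards [eventually_ge_atTop 1] with m hm
  obtain ⟨n, rfl⟩ := Nat.exists_eq_add_of_le' hm
  exact S.map_nonneg' n zero_le_one

theorem star_e : star S.e = S.e := S.e_nonneg.isSelfAdjoint

theorem norm_e_le : ‖S.e‖ ≤ 1 := by
  refine SeqAlg.norm_mk_le_of_eventually zero_le_one ?_
  filter_upwards [eventually_ge_atTop 1] with m hm
  obtain ⟨n, rfl⟩ := Nat.exists_eq_add_of_le' hm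
  exact (S.norm_map_le n 1).trans (norm_one_le' n)

theorem rho_one_le_e (k : ℕ) : S.rho k 1 ≤ S.e := by
  rw [← sub_nonneg, e, rho_apply, ← map_sub]
  refine SeqAlg.mk_nonneg ?_
  filter_upwards [eventually_ge_atTop (k + 1)] with m hm
  obtain ⟨n, rfl⟩ := Nat.exists_eq_add_of_le' (le_trans (Nat.succ_le_succ (Nat.zero_le k)) hm)
  have h : (S.unitSeq - S.transSeq k 1) (n + 1) = S.map n 1 - S.trans (n + 1) k 1 := rfl
  rw [h, S.trans_succ (Nat.succ_le_succ_iff.1 hm), ← map_sub]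
  refine S.map_nonneg' n (sub_nonneg.2 ?_)
  rw [← CStarAlgebra.norm_le_one_iff_of_nonneg _ (S.trans_nonneg n k zero_le_one)]
  exact (S.norm_trans_le n k 1).trans (norm_one_le' k)

/-- `e` is an order unit. -/
theorem rho_le_norm_smul_e (k : ℕ) {x : F k} (hx : IsSelfAdjoint x) :
    S.rho k x ≤ ‖S.rho k x‖ • S.e := by
  have key : ∀ ε > 0, S.rho k x ≤ (‖S.rho k x‖ + ε) • S.e := by
    intro ε hε
    obtain ⟨n, hn, hkn⟩ := ((SeqAlg.eventually_norm_lt (x := S.transSeq k x)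
      (lt_add_of_pos_right _ hε)).and (eventually_ge_atTop k)).exists
    change ‖S.trans n k x‖ < ‖S.rho k x‖ + ε at hn
    have hsa : IsSelfAdjoint (S.trans n k x) := by
      rw [isSelfAdjoint_iff, ← trans_star, hx.star_eq]
    have h1 : 0 ≤ S.rho n (algebraMap ℝ (F n) ‖S.trans n k x‖ - S.trans n k x) :=
      S.rho_nonneg n (sub_nonneg.2 hsa.le_algebraMap_norm_self)
    rw [map_sub, sub_nonneg, S.rho_trans hkn, Algebra.algebraMap_eq_smul_one,
      LinearMap.map_smul_of_tower] at h1
    calc S.rho k x ≤ ‖S.trans n k x‖ • S.rho n 1 := h1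
      _ ≤ ‖S.trans n k x‖ • S.e := smul_le_smul_of_nonneg_left (S.rho_one_le_e n) (norm_nonneg _)
      _ ≤ (‖S.rho k x‖ + ε) • S.e := smul_le_smul_of_nonneg_right hn.le S.e_nonneg
  have hc : Tendsto (fun ε : ℝ => (‖S.rho k x‖ + ε) • S.e) (𝓝[>] 0) (𝓝 (‖S.rho k x‖ • S.e)) := by
    have : Continuous fun ε : ℝ => (‖S.rho k x‖ + ε) • S.e := by fun_prop
    simpa using (this.tendsto 0).mono_left nhdsWithin_le_nhds
  exact ge_of_tendsto hc (by filter_upwards [self_mem_nhdsWithin] with ε hε using key ε hε)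

theorem le_norm_smul_e {z : SeqAlg F} (hz : z ∈ S.limit) (hsa : IsSelfAdjoint z) :
    z ≤ ‖z‖ • S.e := by
  have h : z ∈ {z : SeqAlg F | (1 / 2 : ℝ) • (z + star z) ≤ ‖z‖ • S.e} := by
    refine S.limit_subset (isClosed_le (by fun_prop) (by fun_prop)) (fun n x => ?_) hz
    have hx : IsSelfAdjoint ((1 / 2 : ℝ) • (x + star x)) :=
      (IsSelfAdjoint.all (1 / 2 : ℝ)).smul (IsSelfAdjoint.add_star_self x)
    have h1 := S.rho_le_norm_smul_e n hx
    rw [LinearMap.map_smul_of_tower, map_add, rho_star] at h1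
    refine h1.trans (smul_le_smul_of_nonneg_right ?_ S.e_nonneg)
    rw [norm_smul]
    have := norm_add_le (S.rho n x) (star (S.rho n x))
    rw [norm_star] at this
    norm_num
    linarith
  have h2 : (1 / 2 : ℝ) • (z + star z) = z := by
    rw [hsa.star_eq, ← two_smul ℝ z, smul_smul]
    norm_num
  have h3 : (1 / 2 : ℝ) • (z + star z) ≤ ‖z‖ • S.e := h
  rwa [h2] at h3

end CPCSystem

/-- If `e`, `z` are self-adjoint and `z ^ 2 ≤ c ^ 2 • e ^ 2` with `c = ‖z‖`, and `e`, `z` commute,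
then multiplication by `e ^ 3` does not decrease the norm of `z`. -/
theorem norm_le_norm_mul_of_sq_le {A : Type*} [NonUnitalCStarAlgebra A] [PartialOrder A]
    [StarOrderedRing A] {e z : A} (he : IsSelfAdjoint e) (hz : IsSelfAdjoint z)
    (hez : e * z = z * e) (h1 : z ≤ ‖z‖ • e) (h2 : -z ≤ ‖z‖ • e) :
    ‖z‖ ≤ ‖e * (e * (e * z))‖ := by
  rcases eq_or_ne z 0 with rfl | hz0
  · simp
  set c := ‖z‖ with hc
  have hc0 : 0 < c := norm_pos_iff.2 hz0
  have hq : z * z ≤ (c • e) * (c • e) := by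
    have hcomm : Commute (c • e - z) (c • e + z) := by
      have h : Commute (c • e) z := (show Commute e z from hez).smul_left c
      exact ((Commute.refl _).add_right h).sub_left (h.symm.add_right (Commute.refl _))
    have h3 := Commute.mul_nonneg (sub_nonneg.2 h1) (by simpa using neg_le_iff_add_nonneg.1 h2) hcomm
    rw [← sub_nonneg]
    convert h3 using 1
    rw [sub_mul, mul_add, mul_add, smul_mul_assoc c e z, hez, mul_smul_comm c z e]
    abel
  have key : ∀ y : A, ‖z * y‖ ≤ c * ‖e * y‖ := by
    intro y
    have h3 := star_left_conjugate_le_conjugate hq y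
    have h4 : star y * (z * z) * y = star (z * y) * (z * y) := by
      rw [star_mul, hz.star_eq]; simp only [mul_assoc]
    have h5 : star y * ((c • e) * (c • e)) * y = star (c • (e * y)) * (c • (e * y)) := by
      rw [star_smul, star_mul, he.star_eq]
      simp only [mul_assoc, smul_mul_assoc, mul_smul_comm, star_trivial]
    rw [h4, h5] at h3
    have h6 := CStarAlgebra.norm_le_norm_of_nonneg_of_le (star_mul_self_nonneg _) h3
    rw [CStarRing.norm_star_mul_self, CStarRing.norm_star_mul_self, norm_smul,
      Real.norm_of_nonneg hc0.le] at h6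
    exact (mul_self_le_mul_self_iff (norm_nonneg _) (by positivity)).2 h6
  have hzz : ‖z * z‖ = c * c := by
    have := CStarRing.norm_star_mul_self (x := z)
    rwa [hz.star_eq] at this
  have h4 : ‖z * (z * (z * z))‖ = c * c * (c * c) := by
    have := CStarRing.norm_star_mul_self (x := z * z)
    rw [star_mul, hz.star_eq, hzz] at this
    simpa only [mul_assoc] using this
  have a1 := key (z * (z * z))
  have a2 := key (e * (z * z))
  have a3 := key (e * (e * z))
  have b1 : e * (z * (z * z)) = z * (e * (z * z)) := by
    rw [← mul_assoc, hez, mul_assoc]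
  have b2 : e * (e * (z * z)) = z * (e * (e * z)) := by
    have : e * (z * z) = z * (e * z) := by rw [← mul_assoc, hez, mul_assoc, hez]
    rw [this, ← mul_assoc, hez, mul_assoc]
  rw [b1] at a1
  rw [b2] at a2
  have h5 : c * c * (c * c) ≤ c * (c * (c * ‖e * (e * (e * z))‖)) := by
    calc c * c * (c * c) ≤ c * ‖z * (e * (z * z))‖ := by rw [← h4]; exact a1
      _ ≤ c * (c * ‖z * (e * (e * z))‖) := by gcongr
      _ ≤ c * (c * (c * ‖e * (e * (e * z))‖)) := by gcongr
  have h6 : c * c * c * c ≤ c * c * c * ‖e * (e * (e * z))‖ := by linarith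
  exact le_of_mul_le_mul_left h6 (by positivity)

/-! ### CPC⋆-systems and the product on the limit -/

/-- A CPC⋆-system: a system of finite-dimensional C⋆-algebras which is asymptotically order zero. -/
structure CPCStarSystem (F : ℕ → Type*) [∀ n, CStarAlgebra (F n)] [∀ n, PartialOrder (F n)]
    [∀ n, StarOrderedRing (F n)] extends CPCSystem F where
  finiteDimensional : ∀ n, FiniteDimensional ℂ (F n)
  asymptoticallyOrderZero : ∀ (k : ℕ) (x y : F k) (ε : ℝ), 0 < ε →
    ∃ M, k < M ∧ ∀ m n l, M < n → n < m → M < l → l < m →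
      ‖toCPCSystem.trans m l 1 *
          toCPCSystem.trans m n (toCPCSystem.trans n k x * toCPCSystem.trans n k y)
        - toCPCSystem.trans m k x * toCPCSystem.trans m k y‖ < ε

namespace CPCStarSystem

variable {F : ℕ → Type*} [∀ n, CStarAlgebra (F n)] [∀ n, PartialOrder (F n)]
  [∀ n, StarOrderedRing (F n)] (S : CPCStarSystem F)

theorem tendsto_e_mul {k : ℕ} (x y : F k) :
    Tendsto (fun n => S.e * S.rho n (S.trans n k x * S.trans n k y)) atTop
      (𝓝 (S.rho k x * S.rho k y)) := by
  rw [Metric.tendsto_atTop]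
  intro ε hε
  obtain ⟨M, hkM, hM⟩ := S.asymptoticallyOrderZero k x y (ε / 2) (half_pos hε)
  refine ⟨M + 1, fun n hn => ?_⟩
  rw [dist_eq_norm]
  refine lt_of_le_of_lt ?_ (half_lt_self hε)
  have h : S.e * S.rho n (S.trans n k x * S.trans n k y) - S.rho k x * S.rho k y
      = SeqAlg.mk F (S.unitSeq * S.transSeq n (S.trans n k x * S.trans n k y)
        - S.transSeq k x * S.transSeq k y) := by
    rw [map_sub, SeqAlg.mk_mul, SeqAlg.mk_mul]
    rfl
  rw [h]
  refine SeqAlg.norm_mk_le_of_eventually (half_pos hε).le ?_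
  filter_upwards [eventually_ge_atTop (n + M + 3)] with m hm
  obtain ⟨l, rfl⟩ := Nat.exists_eq_add_of_le' (show 1 ≤ m by omega)
  have h2 := hM (l + 1) n l (by omega) (by omega) (by omega) (by omega)
  have h3 : S.trans (l + 1) l 1 = S.unitSeq (l + 1) := by
    rw [S.trans_succ le_rfl, S.trans_self]
    rfl
  rw [h3] at h2
  exact h2.le

theorem tendsto_mul_e {k : ℕ} (x y : F k) :
    Tendsto (fun n => S.rho n (S.trans n k x * S.trans n k y) * S.e) atTop
      (𝓝 (S.rho k x * S.rho k y)) := by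
  have h := (S.tendsto_e_mul (star y) (star x)).star
  simp only [star_mul, S.star_e, ← S.rho_star, ← S.trans_star, star_star] at h
  exact h

theorem e_comm_rho_mul {k : ℕ} (x y : F k) :
    S.e * (S.rho k x * S.rho k y) = S.rho k x * S.rho k y * S.e := by
  have h1 := (S.tendsto_mul_e x y).const_mul S.e
  have h2 := (S.tendsto_e_mul x y).mul_const S.e
  simp only [mul_assoc] at h1 h2
  rw [mul_assoc]
  exact tendsto_nhds_unique h1 h2

theorem e_comm_rho (k : ℕ) (x : F k) : S.e * S.rho k x = S.rho k x * S.e := by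
  have hx : x ∈ Submodule.span ℂ {a : F k | 0 ≤ a} := by
    rw [CStarAlgebra.span_nonneg]
    trivial
  induction hx using Submodule.span_induction with
  | mem x hx =>
    have h0 : 0 ≤ S.rho k x := S.rho_nonneg k hx
    have h1 : Commute (S.rho k x * S.rho k x) S.e := (S.e_comm_rho_mul x x).symm
    have h2 : Commute (CFC.sqrt (S.rho k x * S.rho k x)) S.e := h1.cfcₙ_nnreal _
    rw [CFC.sqrt_mul_self _ h0] at h2
    exact h2.symm
  | zero => simp
  | add x y _ _ hx hy => rw [map_add, mul_add, add_mul, hx, hy]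
  | smul c x _ hx => rw [map_smul, mul_smul_comm, smul_mul_assoc, hx]

/-- `e` commutes with the limit. -/
theorem e_comm {z : SeqAlg F} (hz : z ∈ S.limit) : S.e * z = z * S.e :=
  S.limit_subset (s := {z | S.e * z = z * S.e})
    (isClosed_eq (by fun_prop) (by fun_prop)) S.e_comm_rho hz

theorem norm_le_of_selfAdjoint {z : SeqAlg F} (hz : z ∈ S.limit) (hsa : IsSelfAdjoint z) :
    ‖z‖ ≤ ‖S.e * (S.e * (S.e * z))‖ := by
  refine norm_le_norm_mul_of_sq_le S.e_nonneg.isSelfAdjoint hsa (S.e_comm hz)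
    (S.le_norm_smul_e hz hsa) ?_
  have := S.le_norm_smul_e (neg_mem hz) hsa.neg
  rwa [norm_neg] at this

theorem norm_e_mul_le (z : SeqAlg F) : ‖S.e * z‖ ≤ ‖z‖ :=
  (norm_mul_le _ _).trans (mul_le_of_le_one_left (norm_nonneg _) S.norm_e_le)

theorem norm_e_mul_of_selfAdjoint {z : SeqAlg F} (hz : z ∈ S.limit) (hsa : IsSelfAdjoint z) :
    ‖S.e * z‖ = ‖z‖ := by
  refine le_antisymm (S.norm_e_mul_le z) ((S.norm_le_of_selfAdjoint hz hsa).trans ?_)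
  exact (S.norm_e_mul_le _).trans (S.norm_e_mul_le _)

/-- A sequence `u` in the limit whose differences are controlled by multiplication with `e`
converges as soon as `e * u n` does. -/
theorem exists_tendsto {u : ℕ → SeqAlg F} (hu : ∀ n, u n ∈ S.limit)
    (hn : ∀ m n, ‖S.e * (u m - u n)‖ = ‖u m - u n‖) {a : SeqAlg F}
    (ha : Tendsto (fun n => S.e * u n) atTop (𝓝 a)) :
    ∃ z ∈ S.limit, Tendsto u atTop (𝓝 z) ∧ S.e * z = a := by
  have hc : CauchySeq u := by
    have h := ha.cauchySeq
    rw [Metric.cauchySeq_iff] at h ⊢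
    intro ε hε
    obtain ⟨N, hN⟩ := h ε hε
    refine ⟨N, fun m hm n hn' => ?_⟩
    have := hN m hm n hn'
    rwa [dist_eq_norm, ← mul_sub, hn, ← dist_eq_norm] at this
  obtain ⟨z, hz⟩ := cauchySeq_tendsto_of_complete hc
  refine ⟨z, S.isClosed_limit.mem_of_tendsto hz (Eventually.of_forall hu), hz, ?_⟩
  exact tendsto_nhds_unique (hz.const_mul S.e) ha

/-- Multiplication by `e` is isometric on the limit. -/
theorem norm_e_mul {z : SeqAlg F} (hz : z ∈ S.limit) : ‖S.e * z‖ = ‖z‖ := by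
  refine S.limit_subset (s := {z | ‖S.e * z‖ = ‖z‖})
    (isClosed_eq (by fun_prop) (by fun_prop)) (fun k x => ?_) hz
  let u : ℕ → SeqAlg F := fun n => S.rho n (S.trans n k (star x) * S.trans n k x)
  have hsa : ∀ n, IsSelfAdjoint (u n) := by
    intro n
    rw [isSelfAdjoint_iff, ← S.rho_star, star_mul, ← S.trans_star, ← S.trans_star, star_star]
  have hu : ∀ n, u n ∈ S.limit := fun n => S.rho_mem n _
  obtain ⟨w, hw, hlim, hew⟩ := S.exists_tendsto hu
    (fun m n => S.norm_e_mul_of_selfAdjoint (sub_mem (hu m) (hu n)) ((hsa m).sub (hsa n)))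
    (S.tendsto_e_mul (star x) x)
  have hwsa : IsSelfAdjoint w := by
    rw [isSelfAdjoint_iff]
    have h := hlim.star
    simp only [(hsa _).star_eq] at h
    exact tendsto_nhds_unique h hlim
  rw [S.rho_star] at hew
  set a := S.rho k x with ha
  have hea : S.e * a = a * S.e := S.e_comm_rho k x
  have h1 : star (S.e * a) * (S.e * a) = S.e * (S.e * (S.e * w)) := by
    have hea' : star a * S.e = S.e * star a := by
      have := congrArg star hea
      rwa [star_mul, star_mul, S.star_e] at this
    rw [hew, star_mul, S.star_e, hea']
    calc S.e * star a * (S.e * a) = S.e * (star a * S.e) * a := by simp only [mul_assoc]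
      _ = S.e * (S.e * (star a * a)) := by rw [hea']; simp only [mul_assoc]
  have h2 : ‖a‖ * ‖a‖ ≤ ‖S.e * a‖ * ‖S.e * a‖ := by
    rw [← CStarRing.norm_star_mul_self, ← CStarRing.norm_star_mul_self, h1, ← hew]
    exact (S.norm_e_mul_le w).trans (S.norm_le_of_selfAdjoint hw hwsa)
  exact le_antisymm (S.norm_e_mul_le a)
    ((mul_self_le_mul_self_iff (norm_nonneg _) (norm_nonneg _)).2 h2)

theorem e_mul_injective {y z : SeqAlg F} (hy : y ∈ S.limit) (hz : z ∈ S.limit)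
    (h : S.e * y = S.e * z) : y = z := by
  have h1 := S.norm_e_mul (sub_mem hy hz)
  rw [mul_sub, h, sub_self, norm_zero] at h1
  exact sub_eq_zero.1 (norm_eq_zero.1 h1.symm)

theorem e_mul_cancel {y z : SeqAlg F} (h : S.e * (S.e * y) = S.e * (S.e * z)) :
    S.e * y = S.e * z := by
  rw [← sub_eq_zero, ← mul_sub, ← mul_sub] at h
  rw [← sub_eq_zero, ← mul_sub, ← CStarRing.star_mul_self_eq_zero_iff, star_mul, S.star_e,
    mul_assoc, h, mul_zero]

theorem exists_tendsto_rho_mul {k : ℕ} (x y : F k) :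
    ∃ z ∈ S.limit, Tendsto (fun n => S.rho n (S.trans n k x * S.trans n k y)) atTop (𝓝 z) ∧
      S.e * z = S.rho k x * S.rho k y :=
  S.exists_tendsto (fun n => S.rho_mem n _)
    (fun m n => S.norm_e_mul (sub_mem (S.rho_mem m _) (S.rho_mem n _))) (S.tendsto_e_mul x y)

theorem isClosed_e_mul_limit : IsClosed ((fun z => S.e * z) '' (S.limit : Set (SeqAlg F))) := by
  rw [← isSeqClosed_iff_isClosed]
  intro v a hv ha
  choose u hu huv using hv
  have ha' : Tendsto (fun n => S.e * u n) atTop (𝓝 a) := by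
    refine ha.congr fun n => ?_
    exact (huv n).symm
  obtain ⟨z, hz, -, hza⟩ := S.exists_tendsto hu
    (fun m n => S.norm_e_mul (sub_mem (hu m) (hu n))) ha'
  exact ⟨z, hz, hza⟩

theorem exists_dot {a b : SeqAlg F} (ha : a ∈ S.limit) (hb : b ∈ S.limit) :
    ∃ z ∈ S.limit, S.e * z = a * b := by
  have hclosed := S.isClosed_e_mul_limit
  refine S.limit_subset
    (s := {a | a * b ∈ (fun z => S.e * z) '' (S.limit : Set (SeqAlg F))})
    (hclosed.preimage (by fun_prop)) (fun j x => ?_) ha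
  refine S.limit_subset
    (s := {b | S.rho j x * b ∈ (fun z => S.e * z) '' (S.limit : Set (SeqAlg F))})
    (hclosed.preimage (by fun_prop)) (fun k y => ?_) hb
  rw [Set.mem_ofPred_eq, ← S.rho_trans (le_max_left j k) x, ← S.rho_trans (le_max_right j k) y]
  obtain ⟨z, hz, -, h⟩ := S.exists_tendsto_rho_mul (S.trans (max j k) j x) (S.trans (max j k) k y)
  exact ⟨z, hz, h⟩

/-- The C⋆-algebra `C⋆_•(X)` of the CPC⋆-system: its underlying involutive Banach space is the limit
`X ⊆ F_∞`, its multiplication is the product `•` below. -/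
def Alg : Type _ := S.limit

namespace Alg

variable {S}

instance : NormedAddCommGroup S.Alg := inferInstanceAs (NormedAddCommGroup S.limit)

instance : NormedSpace ℂ S.Alg := inferInstanceAs (NormedSpace ℂ S.limit)

instance : CompleteSpace S.Alg := S.isClosed_limit.completeSpace_coe

variable (S) in
/-- The identity map `Θ : C⋆_•(X) → F_∞`, i.e. the inclusion of `X` into `F_∞`. -/
def Θ : S.Alg →ₗ[ℂ] SeqAlg F := S.limit.subtype

theorem Θ_mem (x : S.Alg) : Θ S x ∈ S.limit := x.2

theorem ext_iff {x y : S.Alg} : x = y ↔ Θ S x = Θ S y := Subtype.ext_iff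

theorem norm_Θ (x : S.Alg) : ‖Θ S x‖ = ‖x‖ := rfl

/-- The product `x • y`: the unique element `z` of `X` with `e z = x y` in `F_∞`. It is determined
by `ρ_k(x) • ρ_k(y) = lim_n ρ_n(ρ_{n,k}(x) ρ_{n,k}(y))`, see `tendsto_mul` below. -/
instance : Mul S.Alg where
  mul x y := ⟨(S.exists_dot (Θ_mem x) (Θ_mem y)).choose,
    (S.exists_dot (Θ_mem x) (Θ_mem y)).choose_spec.1⟩

/-- The involution of `F_∞`. -/
instance : Star S.Alg where
  star x := ⟨star (Θ S x), S.star_mem_limit (Θ_mem x)⟩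

theorem Θ_star (x : S.Alg) : Θ S (star x) = star (Θ S x) := rfl

theorem e_mul_Θ_mul (x y : S.Alg) : S.e * Θ S (x * y) = Θ S x * Θ S y :=
  (S.exists_dot (Θ_mem x) (Θ_mem y)).choose_spec.2

theorem eq_of_e_mul {x y : S.Alg} (h : S.e * Θ S x = S.e * Θ S y) : x = y :=
  ext_iff.2 (S.e_mul_injective (Θ_mem x) (Θ_mem y) h)

variable (S) in
/-- The element `ρ_k(x)` of the limit. -/
def ofRho (k : ℕ) (x : F k) : S.Alg := ⟨S.rho k x, S.rho_mem k x⟩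

theorem Θ_ofRho (k : ℕ) (x : F k) : Θ S (ofRho S k x) = S.rho k x := rfl

/-- `ρ_k(x) • ρ_k(y) = lim_n ρ_n(ρ_{n,k}(x) ρ_{n,k}(y))`. -/
theorem tendsto_mul {k : ℕ} (x y : F k) :
    Tendsto (fun n => ofRho S n (S.trans n k x * S.trans n k y)) atTop
      (𝓝 (ofRho S k x * ofRho S k y)) := by
  refine tendsto_subtype_rng.2 ?_
  obtain ⟨z, hz, hlim, he⟩ := S.exists_tendsto_rho_mul x y
  have h : z = Θ S (ofRho S k x * ofRho S k y) := by
    refine S.e_mul_injective hz (Θ_mem _) ?_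
    rw [he, e_mul_Θ_mul, Θ_ofRho, Θ_ofRho]
  rw [h] at hlim
  exact hlim

theorem e_comm' (x : S.Alg) : S.e * Θ S x = Θ S x * S.e := S.e_comm (Θ_mem x)

theorem norm_mul_eq (x y : S.Alg) : ‖x * y‖ = ‖Θ S x * Θ S y‖ := by
  rw [← e_mul_Θ_mul, S.norm_e_mul (Θ_mem _), norm_Θ]

instance : NonUnitalRing S.Alg where
  left_distrib a b c := by
    refine eq_of_e_mul ?_
    rw [e_mul_Θ_mul, map_add, map_add, mul_add, mul_add, e_mul_Θ_mul, e_mul_Θ_mul]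
  right_distrib a b c := by
    refine eq_of_e_mul ?_
    rw [e_mul_Θ_mul, map_add, map_add, mul_add, add_mul, e_mul_Θ_mul, e_mul_Θ_mul]
  zero_mul a := by
    refine eq_of_e_mul ?_
    rw [e_mul_Θ_mul, map_zero, zero_mul, mul_zero]
  mul_zero a := by
    refine eq_of_e_mul ?_
    rw [e_mul_Θ_mul, map_zero, mul_zero, mul_zero]
  mul_assoc a b c := by
    have h : S.e * (S.e * Θ S (a * b * c)) = S.e * (S.e * Θ S (a * (b * c))) := by
      rw [e_mul_Θ_mul, e_mul_Θ_mul, ← mul_assoc, e_mul_Θ_mul, ← mul_assoc, e_comm', mul_assoc,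
        mul_assoc, e_mul_Θ_mul]
    exact eq_of_e_mul (S.e_mul_cancel h)

instance : NonUnitalNormedRing S.Alg where
  dist_eq := NormedAddGroup.dist_eq
  norm_mul_le a b := by
    rw [norm_mul_eq]
    exact norm_mul_le (Θ S a) (Θ S b)

instance : StarRing S.Alg where
  star_involutive a := by
    rw [ext_iff, Θ_star, Θ_star, star_star]
  star_mul a b := by
    refine eq_of_e_mul ?_
    rw [e_mul_Θ_mul, Θ_star, Θ_star, Θ_star, ← star_mul, ← e_mul_Θ_mul, star_mul, S.star_e,
      ← Θ_star, e_comm']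
  star_add a b := by
    rw [ext_iff, Θ_star, map_add, map_add, Θ_star, Θ_star, star_add]

instance : CStarRing S.Alg where
  norm_mul_self_le a := by
    rw [norm_mul_eq, Θ_star, CStarRing.norm_star_mul_self, norm_Θ]

instance : NonUnitalCStarAlgebra S.Alg where
  smul_assoc c a b := by
    refine eq_of_e_mul ?_
    rw [smul_eq_mul, smul_eq_mul, e_mul_Θ_mul, map_smul, map_smul, mul_smul_comm, e_mul_Θ_mul,
      smul_mul_assoc]
  smul_comm c a b := by
    refine eq_of_e_mul ?_
    rw [smul_eq_mul, smul_eq_mul, e_mul_Θ_mul, map_smul, map_smul, mul_smul_comm, e_mul_Θ_mul,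
      mul_smul_comm]
  star_smul c a := by
    rw [ext_iff, Θ_star, map_smul, map_smul, Θ_star, star_smul]

instance : PartialOrder S.Alg := CStarAlgebra.spectralOrder _

instance : StarOrderedRing S.Alg := CStarAlgebra.spectralOrderedRing _

end Alg

end CPCStarSystem

/-! ### Order zero maps and complete order embeddings -/

section Maps

variable {A B : Type*} [NonUnitalCStarAlgebra A] [PartialOrder A] [StarOrderedRing A]
  [NonUnitalCStarAlgebra B] [PartialOrder B] [StarOrderedRing B]

/-- A linear map `θ : X → B` on a subspace `X` of `A` is completely positive if for all `r` it maps
matrices in `M_r(X) ∩ M_r(A)_+` to `M_r(B)_+`. -/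
def IsCompletelyPositiveOn {X : Submodule ℂ A} (θ : X →ₗ[ℂ] B) : Prop :=
  ∀ (r : ℕ) (M : CStarMatrix (Fin r) (Fin r) X),
    0 ≤ M.map (fun x => (x : A)) → 0 ≤ M.map (fun x => θ x)

/-- Complete positivity of a linear map on all of `A`. -/
def IsCompletelyPositive (θ : A →ₗ[ℂ] B) : Prop :=
  ∀ (r : ℕ) (M : CStarMatrix (Fin r) (Fin r) A), 0 ≤ M → 0 ≤ M.map θ

/-- All matrix amplifications of `θ` are isometric. -/
def IsCompletelyIsometric (θ : A →ₗ[ℂ] B) : Prop :=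
  ∀ (r : ℕ) (M : CStarMatrix (Fin r) (Fin r) A), ‖M.map θ‖ = ‖M‖

/-- Completely positive maps of order zero, i.e. preserving orthogonality of positive elements. -/
structure IsOrderZero (θ : A →ₗ[ℂ] B) : Prop where
  completelyPositive : IsCompletelyPositive θ
  orthogonal : ∀ a b : A, 0 ≤ a → 0 ≤ b → a * b = 0 → θ a * θ b = 0

/-- Complete order embeddings: completely positive and completely isometric maps whose inverse
`θ⁻¹ : θ(A) → A` is completely positive. -/
structure IsCompleteOrderEmbedding (θ : A →ₗ[ℂ] B) : Prop where
  completelyPositive : IsCompletelyPositive θ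
  completelyIsometric : IsCompletelyIsometric θ
  inverse : ∃ ψ : LinearMap.range θ →ₗ[ℂ] A,
    (∀ a, ψ ⟨θ a, LinearMap.mem_range_self θ a⟩ = a) ∧ IsCompletelyPositiveOn ψ

end Maps

end CPCStar

end

open Filter Topology
open scoped ENNReal

namespace CPCStar

/-! ### Generalities -/

/-! Everything rests on `e * Θ (x * y) = Θ x * Θ y`, where `e ≥ 0` commutes with the limit;
orthogonality is immediate from it. Let `E` be the diagonal matrix with entries `e`. Then `E * Θ (M
* N) = Θ M * Θ N` for matrices, and `E` commutes with each `Θ M`.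

Positivity (`map_Θ_nonneg`): if `M = N⋆ N`, then `E * Θ M = (Θ N)⋆ (Θ N) ≥ 0`. Dividing by `E` is
legitimate because whatever `e` annihilates from the left is annihilated by the whole limit, so the
negative part of `Θ M` must vanish. For the inverse (`nonneg_of_map_Θ_nonneg`), let `P` be the
negative part of `M` in the matrix algebra over `S.Alg`. Then `Θ M * Θ P = -(Θ P)²` is a product of
commuting positive elements, which forces `P = 0`.

Isometry (`norm_map_Θ`): multiplication by every power of `e` is isometric on the limit, so `E ^ j *
Θ N` and `N` have entries of equal norm. The `2 ^ k`-th power of `(Θ M)⋆ (Θ M)` is some `E ^ j`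
times the image of the corresponding power of `M⋆ M`. Entrywise norms determine a matrix norm up to
a factor depending only on the size, and this factor disappears after taking `2 ^ k`-th roots. -/

theorem le_of_forall_pow_two_pow_le_mul {a b K : ℝ} (hb : 0 ≤ b)
    (h : ∀ k : ℕ, a ^ 2 ^ k ≤ K * b ^ 2 ^ k) : a ≤ b := by
  by_contra! hab
  rcases hb.eq_or_lt with rfl | hb
  -- For `b = 0` the exponent `2 ^ 0 = 1` already gives `a ≤ 0`.
  · have := h 0
    simp only [pow_zero, pow_one, mul_zero] at this
    exact absurd hab this.not_gt
  obtain ⟨n, hn⟩ := pow_unbounded_of_one_lt K ((one_lt_div hb).2 hab)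
  have h1 : (a / b) ^ n ≤ (a / b) ^ 2 ^ n :=
    pow_le_pow_right₀ ((one_lt_div hb).2 hab).le Nat.lt_two_pow_self.le
  rw [div_pow a b (2 ^ n), le_div_iff₀ (by positivity)] at h1
  have h2 : K * b ^ 2 ^ n < (a / b) ^ n * b ^ 2 ^ n := by gcongr
  exact absurd (h n) (h2.trans_le h1).not_ge

/-! ### Iterated squares and negative parts in C⋆-algebras -/

section CStar

variable {A : Type*} [NonUnitalCStarAlgebra A]

theorem isSelfAdjoint_iterate_mul_self {x : A} (hx : IsSelfAdjoint x) (k : ℕ) :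
    IsSelfAdjoint ((fun y => y * y)^[k] x) := by
  induction k with
  | zero => exact hx
  | succ k ih =>
    rw [Function.iterate_succ_apply', isSelfAdjoint_iff, star_mul, ih.star_eq]

theorem norm_iterate_mul_self {x : A} (hx : IsSelfAdjoint x) (k : ℕ) :
    ‖(fun y => y * y)^[k] x‖ = ‖x‖ ^ 2 ^ k := by
  induction k with
  | zero => simp
  | succ k ih =>
    rw [Function.iterate_succ_apply', (isSelfAdjoint_iterate_mul_self hx k).norm_mul_self, ih,
      ← pow_mul, pow_succ]

variable [PartialOrder A] [StarOrderedRing A]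

theorem exists_eq_star_mul_self {a : A} (ha : 0 ≤ a) : ∃ s, a = star s * s :=
  CStarAlgebra.nonneg_iff_eq_star_mul_self.1 ha

/-- The defining properties of the negative part of a self-adjoint element. -/
theorem exists_negPart {h : A} (hh : IsSelfAdjoint h) :
    ∃ p, 0 ≤ p ∧ h * p = -(p * p) ∧ p * h = -(p * p) ∧ (p = 0 → 0 ≤ h) ∧
      ∀ e, Commute e h → Commute e p := by
  have hd : h = h⁺ - h⁻ := (CFC.posPart_sub_negPart h hh).symm
  refine ⟨h⁻, CFC.negPart_nonneg h, ?_, ?_, (CFC.negPart_eq_zero_iff h hh).1, fun e he => ?_⟩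
  · calc h * h⁻ = (h⁺ - h⁻) * h⁻ := congrArg (· * h⁻) hd
      _ = -(h⁻ * h⁻) := by rw [sub_mul, CFC.posPart_mul_negPart, zero_sub]
  · calc h⁻ * h = h⁻ * (h⁺ - h⁻) := congrArg (h⁻ * ·) hd
      _ = -(h⁻ * h⁻) := by rw [mul_sub, CFC.negPart_mul_posPart, zero_sub]
  · rw [CFC.negPart_def]
    exact (Commute.cfcₙ_real he.symm _).symm

/-- If `e ≥ 0` commutes with the self-adjoint `h`, `e * h ≥ 0`, and `h` kills the right annihilator
of `e`, then `h ≥ 0`. -/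
theorem nonneg_of_mul_nonneg_of_annihilator {e h : A} (he : 0 ≤ e) (hh : IsSelfAdjoint h)
    (hc : Commute e h) (heh : 0 ≤ e * h) (hann : ∀ y, e * y = 0 → h * y = 0) : 0 ≤ h := by
  obtain ⟨p, hp, hhp, hph, hp0, hcomm⟩ := exists_negPart hh
  have hep : Commute e p := hcomm e hc
  -- With `p` the negative part, `e h p = -e p²` is both `≥ 0` and `≤ 0`. Hence `e p² = 0`, the
  -- annihilator hypothesis gives `h p² = 0`, that is `p³ = 0`, and so `p = 0`.
  have h1 : 0 ≤ e * h * p :=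
    Commute.mul_nonneg heh hp (hep.mul_left (hcomm h (Commute.refl h)))
  have h2 : 0 ≤ e * (p * p) :=
    Commute.mul_nonneg he (Commute.mul_nonneg hp hp (Commute.refl p)) (hep.mul_right hep)
  rw [mul_assoc, hhp, mul_neg] at h1
  have h3 := hann _ (le_antisymm (neg_nonneg.1 h1) h2)
  have hps : star p = p := hp.isSelfAdjoint.star_eq
  rw [← mul_assoc, hhp, neg_mul, neg_eq_zero, mul_assoc] at h3
  have h4 : p * p = 0 := by
    rw [← CStarRing.star_mul_self_eq_zero_iff, star_mul, hps, mul_assoc, h3, mul_zero]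
  exact hp0 (by rw [← CStarRing.star_mul_self_eq_zero_iff, hps, h4])

/-- A product of commuting positive elements is positive, so `-p²` and `p²` are both positive and
`p² = 0`. -/
theorem eq_zero_of_mul_eq_neg_mul_self {h p : A} (hh : 0 ≤ h) (hp : 0 ≤ p) (hc : Commute h p)
    (heq : h * p = -(p * p)) : p = 0 := by
  have h1 := Commute.mul_nonneg hh hp hc
  rw [heq, neg_nonneg] at h1
  rw [← CStarRing.star_mul_self_eq_zero_iff, hp.isSelfAdjoint.star_eq]
  exact le_antisymm h1 (Commute.mul_nonneg hp hp (Commute.refl p))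

end CStar

/-! ### Diagonal matrices and entrywise norm bounds -/

section Matrix

open CStarMatrix WithCStarModule

variable {A : Type*} [NonUnitalCStarAlgebra A] {m n : Type*}
  [Fintype m] [Fintype n]

variable [DecidableEq n]

/-- The diagonal matrix with all diagonal entries equal to `a`. -/
def diagMatrix (n : Type*) [DecidableEq n] (a : A) : CStarMatrix n n A :=
  CStarMatrix.ofMatrix (Matrix.diagonal fun _ => a)

theorem diagMatrix_mul_apply (a : A) (M : CStarMatrix n n A) (i j : n) :
    (diagMatrix n a * M) i j = a * M i j := by
  rw [CStarMatrix.mul_apply, Finset.sum_eq_single i]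
  · simp [diagMatrix]
  · intro k _ hk
    simp [diagMatrix, Matrix.diagonal_apply_ne' _ hk]
  · simp

theorem mul_diagMatrix_apply (a : A) (M : CStarMatrix n n A) (i j : n) :
    (M * diagMatrix n a) i j = M i j * a := by
  rw [CStarMatrix.mul_apply, Finset.sum_eq_single j]
  · simp [diagMatrix]
  · intro k _ hk
    simp [diagMatrix, Matrix.diagonal_apply_ne _ hk]
  · simp

variable [PartialOrder A] [StarOrderedRing A]

theorem diagMatrix_nonneg {a : A} (ha : 0 ≤ a) : 0 ≤ diagMatrix n a := by
  obtain ⟨s, rfl⟩ := exists_eq_star_mul_self ha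
  have h : diagMatrix n (star s * s) = star (diagMatrix n s) * diagMatrix n s := by
    ext i j
    rw [mul_diagMatrix_apply, CStarMatrix.star_apply]
    rcases eq_or_ne i j with rfl | hij
    · simp [diagMatrix]
    · simp [diagMatrix, Matrix.diagonal_apply_ne _ hij, Matrix.diagonal_apply_ne' _ hij]
  rw [h]
  exact star_mul_self_nonneg _

omit [DecidableEq n] in
theorem cstarMatrix_norm_le_sum (M : CStarMatrix m n A) : ‖M‖ ≤ ∑ j, ∑ i, ‖M i j‖ := by
  rw [CStarMatrix.norm_def]
  refine (toCLM M).opNorm_le_bound (by positivity) fun v => ?_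
  simp only [toCLM_apply_eq_sum, Finset.sum_mul]
  refine (pi_norm_le_sum_norm _).trans ?_
  gcongr with i _
  refine (norm_sum_le _ _).trans ?_
  gcongr with j _
  refine (norm_mul_le _ _).trans ?_
  rw [mul_comm]
  gcongr
  exact norm_apply_le_norm v j

-- A matrix norm dominates each entry and is dominated by the sum of the entries. What matters is
-- that the constant depends only on the size, which allows it to be removed by taking roots.
omit [DecidableEq n] in
theorem cstarMatrix_norm_le_of_entries {B : Type*} [NonUnitalCStarAlgebra B] [PartialOrder B]
    [StarOrderedRing B] {M : CStarMatrix m n A} {N : CStarMatrix m n B}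
    (h : ∀ i j, ‖M i j‖ ≤ ‖N i j‖) : ‖M‖ ≤ (Fintype.card n * Fintype.card m) * ‖N‖ := by
  calc ‖M‖ ≤ ∑ j, ∑ i, ‖M i j‖ := cstarMatrix_norm_le_sum M
    _ ≤ ∑ _j : n, ∑ _i : m, ‖N‖ := by
      gcongr with j _ i _
      exact (h i j).trans norm_entry_le_norm
    _ = _ := by simp [mul_assoc]

end Matrix

/-! ### Multiplication by `e` on the limit -/

namespace CPCStarSystem

variable {F : ℕ → Type*} [∀ n, CStarAlgebra (F n)] [∀ n, PartialOrder (F n)]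
  [∀ n, StarOrderedRing (F n)] (S : CPCStarSystem F)

/-- As `e` is an order unit, `±z ≤ ‖z‖ e`; as `e` commutes with `z`, this squares to `z² ≤ ‖z‖² e²`.
Conjugating by `y` and taking norms gives the bound. -/
theorem norm_mul_le_norm_mul_norm_e_mul {z : SeqAlg F} (hz : z ∈ S.limit) (hsa : IsSelfAdjoint z)
    (y : SeqAlg F) : ‖z * y‖ ≤ ‖z‖ * ‖S.e * y‖ := by
  have hez : Commute S.e z := S.e_comm hz
  have h1 : z ≤ ‖z‖ • S.e := S.le_norm_smul_e hz hsa
  have h2 : -z ≤ ‖z‖ • S.e := by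
    simpa only [norm_neg] using S.le_norm_smul_e (neg_mem hz) hsa.neg
  have hcez : Commute (‖z‖ • S.e) z := hez.smul_left _
  have hcomm : Commute (‖z‖ • S.e - z) (‖z‖ • S.e + z) :=
    ((Commute.refl _).add_right hcez).sub_left (hcez.symm.add_right (Commute.refl _))
  have hq : z * z ≤ (‖z‖ • S.e) * (‖z‖ • S.e) := by
    -- The difference of the two squares factors as `(‖z‖ e - z) (‖z‖ e + z)`, a product of
    -- commuting positive elements.
    have h3 := Commute.mul_nonneg (sub_nonneg.2 h1) (by simpa using neg_le_iff_add_nonneg.1 h2) hcomm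
    rw [← sub_nonneg]
    convert h3 using 1
    rw [sub_mul, mul_add, mul_add, hcez.eq]
    abel
  have h3 := star_left_conjugate_le_conjugate hq y
  have h4 : star y * (z * z) * y = star (z * y) * (z * y) := by
    rw [star_mul, hsa.star_eq]; simp only [mul_assoc]
  have h5 : star y * ((‖z‖ • S.e) * (‖z‖ • S.e)) * y
      = star (‖z‖ • (S.e * y)) * (‖z‖ • (S.e * y)) := by
    rw [star_smul, star_mul, S.star_e]
    simp only [mul_assoc, smul_mul_assoc, mul_smul_comm, star_trivial]
  rw [h4, h5] at h3
  have h6 := CStarAlgebra.norm_le_norm_of_nonneg_of_le (star_mul_self_nonneg _) h3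
  rw [CStarRing.norm_star_mul_self, CStarRing.norm_star_mul_self, norm_smul, norm_norm] at h6
  exact (mul_self_le_mul_self_iff (norm_nonneg _) (by positivity)).2 h6

/-- The iterate `(S.e * ·)^[j]` stands for multiplication by `e ^ j`; it makes sense at `j = 0`
without a unit. -/
theorem norm_iterate_e_mul_le (j : ℕ) (y : SeqAlg F) : ‖(S.e * ·)^[j] y‖ ≤ ‖y‖ := by
  induction j with
  | zero => simp
  | succ j ih =>
    rw [Function.iterate_succ_apply']
    exact (S.norm_e_mul_le _).trans ih

theorem iterate_e_mul_mul (j : ℕ) (x y : SeqAlg F) :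
    (S.e * ·)^[j] (x * y) = (S.e * ·)^[j] x * y := by
  induction j with
  | zero => rfl
  | succ j ih => rw [Function.iterate_succ_apply', ih, Function.iterate_succ_apply', mul_assoc]

theorem mul_iterate_e_mul {x : SeqAlg F} (hx : x ∈ S.limit) (j : ℕ) (y : SeqAlg F) :
    x * (S.e * ·)^[j] y = (S.e * ·)^[j] (x * y) := by
  induction j with
  | zero => rfl
  | succ j ih =>
    rw [Function.iterate_succ_apply', Function.iterate_succ_apply', ← ih, ← mul_assoc,
      ← S.e_comm hx, mul_assoc]

theorem star_iterate_e_mul {x : SeqAlg F} (hx : x ∈ S.limit) (j : ℕ) :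
    star ((S.e * ·)^[j] x) = (S.e * ·)^[j] (star x) := by
  induction j with
  | zero => rfl
  | succ j ih =>
    -- `e ^ i * y` need not lie in the limit, so `S.e_comm` is applied to `y` itself.
    have h : ∀ i, ∀ y ∈ S.limit, (S.e * ·)^[i] y * S.e = S.e * (S.e * ·)^[i] y := by
      intro i y hy
      rw [← S.iterate_e_mul_mul, ← S.e_comm hy, ← Function.iterate_succ_apply' (S.e * ·),
        Function.iterate_succ_apply]
    rw [Function.iterate_succ_apply', Function.iterate_succ_apply', star_mul, ih, S.star_e,
      h j _ (S.star_mem_limit hx)]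

/-- The square of `e ^ j * x` is `e ^ (2 * j) * (x^* * x)`. -/
theorem norm_iterate_e_mul_sq {x : SeqAlg F} (hx : x ∈ S.limit) (j : ℕ) :
    ‖(S.e * ·)^[j] x‖ * ‖(S.e * ·)^[j] x‖ = ‖(S.e * ·)^[j + j] (star x * x)‖ := by
  rw [← CStarRing.norm_star_mul_self, S.star_iterate_e_mul hx, ← S.iterate_e_mul_mul,
    S.mul_iterate_e_mul (S.star_mem_limit hx), ← Function.iterate_add_apply]

/-- Since `e` is a contraction, `‖e ^ i * y‖` decreases in `i`; no loss at stage `j` means no loss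
before it. -/
theorem norm_iterate_e_mul_of_le {i j : ℕ} (h : i ≤ j) {y : SeqAlg F}
    (hy : ‖(S.e * ·)^[j] y‖ = ‖y‖) : ‖(S.e * ·)^[i] y‖ = ‖y‖ := by
  refine le_antisymm (S.norm_iterate_e_mul_le i y) ?_
  obtain ⟨k, rfl⟩ := Nat.exists_eq_add_of_le' h
  rw [Function.iterate_add_apply] at hy
  exact hy.symm.le.trans (S.norm_iterate_e_mul_le k _)

/-- `S.norm_e_mul` cannot simply be iterated, as `e * z` may leave the limit. Instead, isometry at
`j` gives `‖z‖² = ‖z * e ^ (2 j) * z‖ ≤ ‖z‖ ‖e ^ (2 j + 1) * z‖`, hence isometry at `2 j + 1`, which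
is at least `j + 1`. -/
theorem norm_iterate_e_mul_of_selfAdjoint {z : SeqAlg F} (hz : z ∈ S.limit)
    (hsa : IsSelfAdjoint z) (j : ℕ) : ‖(S.e * ·)^[j] z‖ = ‖z‖ := by
  induction j with
  | zero => rfl
  | succ j ih =>
    refine S.norm_iterate_e_mul_of_le (show j + 1 ≤ j + j + 1 by omega)
      (le_antisymm (S.norm_iterate_e_mul_le _ z) ?_)
    rcases eq_or_ne z 0 with rfl | hz0
    · simp
    have h1 := S.norm_iterate_e_mul_sq hz j
    rw [ih, hsa.star_eq, ← S.mul_iterate_e_mul hz] at h1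
    have h2 := S.norm_mul_le_norm_mul_norm_e_mul hz hsa ((S.e * ·)^[j + j] z)
    rw [← h1, ← Function.iterate_succ_apply' (S.e * ·)] at h2
    exact le_of_mul_le_mul_left h2 (norm_pos_iff.2 hz0)

namespace Alg

variable {S}

/-- Multiplication by powers of `e` is isometric on the limit. -/
theorem norm_iterate_e_mul_Θ (x : S.Alg) (j : ℕ) : ‖(S.e * ·)^[j] (Θ S x)‖ = ‖x‖ := by
  have hsa : IsSelfAdjoint (Θ S (star x * x)) := by
    rw [isSelfAdjoint_iff, ← Θ_star, star_mul, star_star]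
  have hx : ‖star x * x‖ = ‖x‖ * ‖x‖ := CStarRing.norm_star_mul_self
  have h := S.norm_iterate_e_mul_sq (Θ_mem x) j
  -- Replacing `(Θ x)⋆ (Θ x)` by `e * Θ (x⋆ x)` costs one more power of `e` and reduces the claim to
  -- a self-adjoint element of the limit.
  rw [← Θ_star, ← e_mul_Θ_mul, ← Function.iterate_succ_apply (S.e * ·),
    S.norm_iterate_e_mul_of_selfAdjoint (Θ_mem _) hsa, norm_Θ, hx] at h
  exact (mul_self_inj (norm_nonneg _) (norm_nonneg _)).1 h

/-- `(Θ x * y)⋆ (Θ x * y) = y⋆ Θ (x⋆ x) e y = 0`, because `e` can be moved next to `y`. -/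
theorem Θ_mul_eq_zero_of_e_mul (x : S.Alg) {y : SeqAlg F} (h : S.e * y = 0) : Θ S x * y = 0 := by
  rw [← CStarRing.star_mul_self_eq_zero_iff, star_mul, mul_assoc, ← mul_assoc (star (Θ S x)),
    ← Θ_star, ← e_mul_Θ_mul, e_comm', mul_assoc, h, mul_zero, mul_zero]

/-! ### Matrices over the limit -/

section Matrix

variable {r : ℕ}

theorem map_Θ_star (M : CStarMatrix (Fin r) (Fin r) S.Alg) :
    (star M).map (Θ S) = star (M.map (Θ S)) := by
  ext i j
  rfl

theorem map_Θ_injective :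
    Function.Injective fun M : CStarMatrix (Fin r) (Fin r) S.Alg => M.map (Θ S) :=
  CStarMatrix.map_injective fun _ _ h => ext_iff.2 h

theorem diagMatrix_mul_map_Θ_mul (M N : CStarMatrix (Fin r) (Fin r) S.Alg) :
    diagMatrix (Fin r) S.e * (M * N).map (Θ S) = M.map (Θ S) * N.map (Θ S) := by
  ext i j
  rw [diagMatrix_mul_apply, CStarMatrix.map_apply, CStarMatrix.mul_apply, CStarMatrix.mul_apply,
    map_sum, Finset.mul_sum]
  simp only [e_mul_Θ_mul, CStarMatrix.map_apply]

theorem diagMatrix_comm_map_Θ (M : CStarMatrix (Fin r) (Fin r) S.Alg) :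
    Commute (diagMatrix (Fin r) S.e) (M.map (Θ S)) := by
  ext i j
  rw [diagMatrix_mul_apply, mul_diagMatrix_apply, CStarMatrix.map_apply, e_comm']

theorem map_Θ_mul_eq_zero (M : CStarMatrix (Fin r) (Fin r) S.Alg)
    {Y : CStarMatrix (Fin r) (Fin r) (SeqAlg F)} (h : diagMatrix (Fin r) S.e * Y = 0) :
    M.map (Θ S) * Y = 0 := by
  ext i j
  rw [CStarMatrix.mul_apply]
  refine Finset.sum_eq_zero fun k _ => Θ_mul_eq_zero_of_e_mul _ ?_
  rw [← diagMatrix_mul_apply, h, CStarMatrix.zero_apply]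

/-- Writing `M = N⋆ N` makes `E * Θ M` positive, and `map_Θ_mul_eq_zero` supplies the annihilator
condition needed to cancel `E`. -/
theorem map_Θ_nonneg {M : CStarMatrix (Fin r) (Fin r) S.Alg} (hM : 0 ≤ M) : 0 ≤ M.map (Θ S) := by
  obtain ⟨N, rfl⟩ := exists_eq_star_mul_self hM
  refine nonneg_of_mul_nonneg_of_annihilator (diagMatrix_nonneg S.e_nonneg) ?_
    (diagMatrix_comm_map_Θ _) ?_ fun Y hY => map_Θ_mul_eq_zero _ hY
  · rw [isSelfAdjoint_iff, ← map_Θ_star, (IsSelfAdjoint.star_mul_self N).star_eq]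
  · rw [diagMatrix_mul_map_Θ_mul, map_Θ_star]
    exact star_mul_self_nonneg _

/-- The negative part is taken upstairs, over `S.Alg`. Its image is positive by `map_Θ_nonneg`, and
the relation `M P = -P²` passes to the images after multiplication by `E`. -/
theorem nonneg_of_map_Θ_nonneg {M : CStarMatrix (Fin r) (Fin r) S.Alg} (hM : 0 ≤ M.map (Θ S)) :
    0 ≤ M := by
  have hsa : IsSelfAdjoint M := by
    rw [isSelfAdjoint_iff]
    refine map_Θ_injective ?_
    simp only [map_Θ_star, (IsSelfAdjoint.of_nonneg hM).star_eq]
  obtain ⟨P, hP0, hMP, hPM, hP, -⟩ := exists_negPart hsa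
  have hΘP : 0 ≤ P.map (Θ S) := map_Θ_nonneg hP0
  have h1 : M.map (Θ S) * P.map (Θ S) = -(P.map (Θ S) * P.map (Θ S)) := by
    have hneg : (-(P * P)).map (Θ S) = -(P * P).map (Θ S) := by
      ext i j
      exact map_neg (Θ S) _
    rw [← diagMatrix_mul_map_Θ_mul, hMP, hneg, mul_neg, diagMatrix_mul_map_Θ_mul]
  -- Both products of images are `E` times the image of `-P²`, since `M P = P M = -P²`.
  have hc : Commute (M.map (Θ S)) (P.map (Θ S)) := by
    refine (diagMatrix_mul_map_Θ_mul _ _).symm.trans ?_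
    rw [hMP, ← hPM, diagMatrix_mul_map_Θ_mul]
  refine hP (map_Θ_injective ((eq_zero_of_mul_eq_neg_mul_self hM hΘP hc h1).trans ?_))
  ext i j
  exact (map_zero (Θ S)).symm

theorem iterate_diagMatrix_mul_apply (j : ℕ) (Y : CStarMatrix (Fin r) (Fin r) (SeqAlg F))
    (i k : Fin r) :
    ((diagMatrix (Fin r) S.e * ·)^[j] Y) i k = (S.e * ·)^[j] (Y i k) := by
  induction j with
  | zero => rfl
  | succ j ih =>
    rw [Function.iterate_succ_apply', diagMatrix_mul_apply, ih, Function.iterate_succ_apply']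

theorem iterate_diagMatrix_mul_mul (j : ℕ) (X Y : CStarMatrix (Fin r) (Fin r) (SeqAlg F)) :
    (diagMatrix (Fin r) S.e * ·)^[j] (X * Y) = (diagMatrix (Fin r) S.e * ·)^[j] X * Y := by
  induction j with
  | zero => rfl
  | succ j ih => rw [Function.iterate_succ_apply', ih, Function.iterate_succ_apply', mul_assoc]

theorem map_Θ_mul_iterate_diagMatrix_mul (M : CStarMatrix (Fin r) (Fin r) S.Alg) (j : ℕ)
    (Y : CStarMatrix (Fin r) (Fin r) (SeqAlg F)) :
    M.map (Θ S) * (diagMatrix (Fin r) S.e * ·)^[j] Y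
      = (diagMatrix (Fin r) S.e * ·)^[j] (M.map (Θ S) * Y) := by
  induction j with
  | zero => rfl
  | succ j ih =>
    rw [Function.iterate_succ_apply', Function.iterate_succ_apply', ← ih, ← mul_assoc,
      ← (diagMatrix_comm_map_Θ M).eq, mul_assoc]

/-- The iterated squares of `M^* * M` in `F_∞` and in `C⋆_•(X)` agree up to a power of `e`. -/
theorem exists_iterate_diagMatrix_mul_eq (M : CStarMatrix (Fin r) (Fin r) S.Alg) (k : ℕ) :
    ∃ j, (diagMatrix (Fin r) S.e * ·)^[j] (((fun N => N * N)^[k] (star M * M)).map (Θ S))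
      = (fun N => N * N)^[k] (star (M.map (Θ S)) * M.map (Θ S)) := by
  induction k with
  | zero => exact ⟨1, by simp [diagMatrix_mul_map_Θ_mul, map_Θ_star]⟩
  | succ k ih =>
    obtain ⟨j, hj⟩ := ih
    -- Squaring `E ^ j * Θ N` gives `E ^ (2 j) * (Θ N)²`, and `(Θ N)² = E * Θ (N²)` contributes the
    -- extra factor.
    refine ⟨j + j + 1, ?_⟩
    rw [Function.iterate_succ_apply' _ k, Function.iterate_succ_apply' _ k,
      Function.iterate_succ_apply, diagMatrix_mul_map_Θ_mul, ← hj, Function.iterate_add_apply,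
      ← map_Θ_mul_iterate_diagMatrix_mul, iterate_diagMatrix_mul_mul]

/-- A power trick: isometry of `e ^ j` on single entries bounds the matrix norms against each other
up to the factor `r²`, uniformly in `k`. By the C⋆-identity the bound concerns `‖M‖ ^ (2 * 2 ^ k)`,
so the factor drops out. -/
theorem norm_map_Θ (M : CStarMatrix (Fin r) (Fin r) S.Alg) : ‖M.map (Θ S)‖ = ‖M‖ := by
  have hsq : ∀ {A : Type _} [NonUnitalCStarAlgebra A] (x : A) (k : ℕ),
      ‖(fun y => y * y)^[k] (star x * x)‖ = (‖x‖ * ‖x‖) ^ 2 ^ k := by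
    intro A _ x k
    rw [norm_iterate_mul_self (IsSelfAdjoint.star_mul_self x), CStarRing.norm_star_mul_self]
  have hent : ∀ (N : CStarMatrix (Fin r) (Fin r) S.Alg) (j : ℕ) (i k : Fin r),
      ‖((diagMatrix (Fin r) S.e * ·)^[j] (N.map (Θ S))) i k‖ = ‖N i k‖ := by
    intro N j i k
    rw [iterate_diagMatrix_mul_apply, CStarMatrix.map_apply, norm_iterate_e_mul_Θ]
  -- The argument is symmetric, because corresponding entries have equal norm; both inequalities run
  -- through the same reduction.
  refine le_antisymm ?_ ?_ <;>
    refine (mul_self_le_mul_self_iff (norm_nonneg _) (norm_nonneg _)).2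
      (le_of_forall_pow_two_pow_le_mul (K := Fintype.card (Fin r) * Fintype.card (Fin r))
        (by positivity) fun k => ?_) <;>
    obtain ⟨j, hj⟩ := exists_iterate_diagMatrix_mul_eq M k <;>
    rw [← hsq, ← hsq, ← hj]
  · exact cstarMatrix_norm_le_of_entries fun i k => (hent _ j i k).le
  · exact cstarMatrix_norm_le_of_entries fun i k => (hent _ j i k).ge

end Matrix

/-! ### Order zero and complete order embedding for `Θ` -/

theorem isCompletelyPositive_Θ : IsCompletelyPositive (Θ S) := fun _ _ => map_Θ_nonneg

theorem isOrderZero_Θ : IsOrderZero (Θ S) where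
  completelyPositive := isCompletelyPositive_Θ
  orthogonal a b _ _ hab := by rw [← e_mul_Θ_mul, hab, map_zero, mul_zero]

theorem isCompleteOrderEmbedding_Θ : IsCompleteOrderEmbedding (Θ S) where
  completelyPositive := isCompletelyPositive_Θ
  completelyIsometric _ := norm_map_Θ
  inverse := by
    have hinj : Function.Injective (Θ S) := fun _ _ h => ext_iff.2 h
    have hΘ : ∀ x, Θ S ((LinearEquiv.ofInjective (Θ S) hinj).symm x) = x := fun x =>
      congrArg Subtype.val ((LinearEquiv.ofInjective (Θ S) hinj).apply_symm_apply x)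
    refine ⟨(LinearEquiv.ofInjective (Θ S) hinj).symm.toLinearMap, fun a =>
      (LinearEquiv.ofInjective (Θ S) hinj).symm_apply_apply a, fun r M hM => ?_⟩
    -- Applying `Θ` to the preimage matrix restores `M`, so the positivity required here is `hM`.
    refine nonneg_of_map_Θ_nonneg ?_
    convert hM using 1
    ext i j
    exact hΘ _

end Alg

end CPCStarSystem

end CPCStar

theorem mainTheorem3 {F : ℕ → Type*} [∀ n, CStarAlgebra (F n)] [∀ n, PartialOrder (F n)]
    [∀ n, StarOrderedRing (F n)] (S : CPCStar.CPCStarSystem F) :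
    CPCStar.IsOrderZero (CPCStar.CPCStarSystem.Alg.Θ S) ∧
      CPCStar.IsCompleteOrderEmbedding (CPCStar.CPCStarSystem.Alg.Θ S) :=
  ⟨CPCStar.CPCStarSystem.Alg.isOrderZero_Θ, CPCStar.CPCStarSystem.Alg.isCompleteOrderEmbedding_Θ⟩
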